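/- Write $\mathrm{GL}^+(3)=\{F\in\mathbb R^{3\times3}:\det F>0\}$, let $\mathrm{Sym}(3)$ be the space of symmetric real $3\times3$ matrices, $\langle X,Y\rangle=\operatorname{tr}(XY^{\mathsf T})$, $\|X\|^2=\langle X,X\rangle$, and $\operatorname{cof}F=\det(F)\,F^{-\mathsf T}$. Let $0<\beta\le\tfrac{27}{4}$ and $c\in\mathbb R$, and define $W:\mathrm{GL}^+(3)\to\mathbb R\cup\{\infty\}$ by $$W(F)=\frac{\|F\|^3}{\beta-\log^2(\det F)}-\frac{3\sqrt3}{\beta}\det F+c\quad\text{if }\log^2(\det F)<\beta,\qquad W(F)=\infty\quad\text{otherwise.}$$ Then: 1. $W$ is polyconvex: there is a convex function $\mathcal P:\mathbb R^{3\times3}\times\mathbb R^{3\times3}\times(0,\infty)\to\mathbb R\cup\{\infty\}$ with $W(F)=\mathcal P(F,\operatorname{cof}F,\det F)$ for all $F\in\mathrm{GL}^+(3)$. 2. $W$ is a function of the Hencky strain $\log V$ alone, where $V=\sqrt{FF^{\mathsf T}}$: with $\widehat W(S)=W(\exp S)$ for $S\in\mathrm{Sym}(3)$, one has $W(F)=\widehat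 W(\log V)$ for all $F\in\mathrm{GL}^+(3)$. The set of admissible Hencky strains $\mathcal C=\{S\in\mathrm{Sym}(3):\widehat W(S)<\infty\}=\{S:(\operatorname{tr}S)^2<\beta\}$ is open, and $\widehat W$ is differentiable on $\mathcal C$, so that the Cauchy stress $\widehat\sigma(S)=\frac1{\det(\exp S)}\,\mathrm D\widehat W(S)\in\mathrm{Sym}(3)$ is defined on $\mathcal C$, where $\mathrm D\widehat W$ is the gradient with respect to $\langle\cdot,\cdot\rangle$. 3. (TSTS-M$^{++}$ on the restricted domain) $\widehat\sigma$ is differentiable at every $S\in\mathcal C$, and $$\langle\mathrm D\widehat\sigma(S).H,\,H\rangle>0\quad\text{for all }S\in\mathcal C\text{ and all }H\in\mathrm{Sym}(3)\setminus\{0\}.$$ 4. (TSTS-M$^{+}$ on the restricted domain) For all $S,\overline S\in\mathcal C$ with $S\neq\overline S$, $$\langle\widehat\sigma(\overline S)-\widehat\sigma(S),\,\overline S-S\rangle>0.$$ -/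

import Mathlib

open scoped Matrix

attribute [local instance] Matrix.frobeniusSeminormedAddCommGroup
  Matrix.frobeniusNormedAddCommGroup Matrix.frobeniusNormedSpace

namespace Hyperelasticity

/-- Second-order tensors on three-dimensional space. They carry the Frobenius norm. -/
abbrev Tensor := Matrix (Fin 3) (Fin 3) ℝ

theorem frobenius_sq_eq_trace (A : Tensor) : ‖A‖ ^ 2 = (A * Aᵀ).trace := by
  rw [Matrix.frobenius_norm_def, ← Real.sqrt_eq_rpow, Real.sq_sqrt (by positivity)]
  simp only [Matrix.trace, Matrix.diag_apply, Matrix.mul_apply, Matrix.transpose_apply]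
  refine Finset.sum_congr rfl fun i _ => Finset.sum_congr rfl fun j _ => ?_
  rw [Real.rpow_two, Real.norm_eq_abs, sq_abs, sq]

/-- The double contraction `⟨X, Y⟩ = tr (X Yᵀ)`, the inner product of the Frobenius norm. -/
noncomputable instance tensorInnerProductSpace : InnerProductSpace ℝ Tensor where
  toNormedSpace := Matrix.frobeniusNormedSpace
  inner X Y := (X * Yᵀ).trace
  norm_sq_eq_re_inner A := frobenius_sq_eq_trace A
  conj_inner_symm X Y := by
    rw [conj_trivial, ← Matrix.trace_transpose, Matrix.transpose_mul, Matrix.transpose_transpose]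
  add_left X Y Z := by rw [Matrix.add_mul, Matrix.trace_add]
  smul_left X Y r := by rw [Matrix.smul_mul, Matrix.trace_smul, conj_trivial, smul_eq_mul]

/-- The space `Sym(3)` of symmetric tensors. -/
def Sym3 : Submodule ℝ Tensor where
  carrier := {A | Aᵀ = A}
  add_mem' {A B} hA hB := by
    change (A + B)ᵀ = A + B
    change Aᵀ = A at hA
    change Bᵀ = B at hB
    rw [Matrix.transpose_add, hA, hB]
  zero_mem' := Matrix.transpose_zero
  smul_mem' r A hA := by
    change (r • A)ᵀ = r • A
    change Aᵀ = A at hA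
    rw [Matrix.transpose_smul, hA]

/-- The cofactor `cof F = det F • F⁻ᵀ` of an invertible tensor. -/
noncomputable def cof (F : Tensor) : Tensor := F.det • (F⁻¹)ᵀ

/-! ### Polyconvexity -/

/-- Convexity on `s` of a function with values in `ℝ ∪ {∞}`; in `EReal` one has `0 * ⊤ = 0`. -/
def ExtConvexOn {E : Type*} [AddCommGroup E] [Module ℝ E] (s : Set E) (f : E → EReal) : Prop :=
  Convex ℝ s ∧ (∀ x ∈ s, f x ≠ ⊥) ∧
    ∀ x ∈ s, ∀ y ∈ s, ∀ a b : ℝ, 0 ≤ a → 0 ≤ b → a + b = 1 →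
      f (a • x + b • y) ≤ (a : EReal) * f x + (b : EReal) * f y

/-- Polyconvexity of an energy on `GL⁺(3)` with values in `ℝ ∪ {∞}`: it equals
`P (F, cof F, det F)` for a convex function `P` on `ℝ^{3×3} × ℝ^{3×3} × ℝ⁺`. -/
def IsPolyconvex (W : Tensor → EReal) : Prop :=
  ∃ P : Tensor × Tensor × ℝ → EReal,
    ExtConvexOn {X : Tensor × Tensor × ℝ | 0 < X.2.2} P ∧
      ∀ F : Tensor, 0 < F.det → W F = P (F, cof F, F.det)

/-! ### Hencky strain and Cauchy stress -/

/-- The left stretch tensor `V = √(F Fᵀ)`. -/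
noncomputable def leftStretch (F : Tensor) : Tensor := cfc Real.sqrt (F * Fᵀ)

/-- The Hencky strain `log V`, as an element of `Sym(3)`. -/
noncomputable def henckyStrain (F : Tensor) : Sym3 :=
  ⟨cfc Real.log (leftStretch F), by
    have h : IsSelfAdjoint (cfc Real.log (leftStretch F)) := cfc_predicate _ _
    have h' : (cfc Real.log (leftStretch F))ᴴ = cfc Real.log (leftStretch F) := h
    rwa [Matrix.conjTranspose_eq_transpose_of_trivial] at h'⟩

/-- The energy in terms of the Hencky strain: the value of `W` at the pure stretch
`V = exp S` whose Hencky strain is `S`. -/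
noncomputable def henckyEnergy (W : Tensor → EReal) (S : Sym3) : EReal :=
  W (NormedSpace.exp (S : Tensor))

/-- `W` is a function of the Hencky strain alone: `W F = Ŵ (log V)` on `GL⁺(3)`. -/
def FactorsThroughHencky (W : Tensor → EReal) : Prop :=
  ∀ F : Tensor, 0 < F.det → W F = henckyEnergy W (henckyStrain F)

/-- The admissible Hencky strains: those of finite energy. -/
def admissible (W : Tensor → EReal) : Set Sym3 := {S | henckyEnergy W S < ⊤}

/-- The real-valued energy on the admissible Hencky strains. -/
noncomputable def realEnergy (W : Tensor → EReal) (S : Sym3) : ℝ := (henckyEnergy W S).toReal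

/-- The Cauchy stress `σ̂ (log V) = J⁻¹ D_{log V} Ŵ (log V)`, where `J = det V`. -/
noncomputable def cauchyStress (W : Tensor → EReal) (S : Sym3) : Sym3 :=
  (Matrix.det (NormedSpace.exp (S : Tensor)))⁻¹ • gradient (realEnergy W) S

/-- The Cauchy stress is derived from a differentiable energy on an open set of
admissible Hencky strains. -/
def HasCauchyStress (W : Tensor → EReal) : Prop :=
  IsOpen (admissible W) ∧ DifferentiableOn ℝ (realEnergy W) (admissible W)

/-- TSTS-M⁺⁺ on the admissible Hencky strains: `D_{log V} σ̂` exists and is positive definite. -/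
def IsTSTSMpp (W : Tensor → EReal) : Prop :=
  HasCauchyStress W ∧ ∀ S ∈ admissible W, DifferentiableAt ℝ (cauchyStress W) S ∧
    ∀ H : Sym3, H ≠ 0 → 0 < inner ℝ (fderiv ℝ (cauchyStress W) S H) H

/-- TSTS-M⁺ on the admissible Hencky strains: `σ̂` is strictly monotone. -/
def IsTSTSMp (W : Tensor → EReal) : Prop :=
  HasCauchyStress W ∧ ∀ S ∈ admissible W, ∀ S' ∈ admissible W, S ≠ S' →
    0 < inner ℝ (cauchyStress W S' - cauchyStress W S) (S' - S)

/-! ### The volume-limited energy -/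

open Classical in
/-- The energy `‖F‖³ / (β - log² det F) - (3√3 / β) det F + c` where `log² det F < β`,
and `∞` otherwise, for `F` in `GL⁺(3)`. -/
noncomputable def volumeLimitedEnergy (β c : ℝ) (F : Tensor) : EReal :=
  if 0 < F.det ∧ Real.log F.det ^ 2 < β then
    ((‖F‖ ^ 3 / (β - Real.log F.det ^ 2) - 3 * Real.sqrt 3 / β * F.det + c : ℝ) : EReal)
  else ⊤

end Hyperelasticity

/-!
The cofactor plays no role in polyconvexity: `W F` depends on `‖F‖` and `d = det F` only, and
`x³ / s²` is jointly convex, increasing in `x ≥ 0` and decreasing in `s > 0`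
(`cube_div_sq_le`). It is composed with the convex function `x = ‖F‖` and with
`s = √(β - log² d)`, which is concave on its domain (`concaveOn_sqrt_sub_log_sq`) because
`β - β t + t³ ≥ 0` for `t = log d`. This is where `β ≤ 27 / 4` is sharp.

Since `exp (log V)` is a symmetric square root of `F Fᵀ` with positive determinant
(`exp_henckyStrain_sq`), it has the norm and the determinant of `F`, so `W` factors through the
Hencky strain. With `t = tr S`, `N = tr (exp (2S)) = ‖exp S‖²` and `k = 3 √3 / β`, the energy is
`N^(3/2) / (β - t²) - k eᵗ + c`; the volumetric term `-k eᵗ` adds only the constant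
multiple `-k` of the identity to the Cauchy stress, so it drops out of both monotonicity
statements.

Differentiating the stress requires the derivative of the matrix exponential in a direction `H`
that need not commute with `S`. Duhamel's formula is used in a weak form
(`exists_apply_fderiv_exp`): under a linear functional, the derivative of `exp` at `A` along `H`
equals the value of `exp ((1 - s) A) H exp (s A)` for some `s ∈ [0, 1]`. For a trace this gives
`tr (exp A H)`. For the second derivative it gives the square of the norm of
`exp ((1 - s) S) H exp (s S)`, and Cauchy-Schwarz with `exp S` bounds it below
(`trace_fderiv_exp_mul`): with `m = tr (exp (2S) H) / N` and `V` the normalized second derivative,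
`V ≥ m²` and `V > 0`. Up to a positive factor, `⟨Dσ̂(S).H, H⟩` is then `6 V + 3 m²` plus terms in
`m tr H` and `(tr H)²`, and completing the square (`stress_form_pos`) shows that it is positive
as soon as `β < 8`. Strict monotonicity follows along segments because the admissible set is
convex.
-/

namespace Hyperelasticity

/-! ### The derivative of the exponential of a Banach algebra -/

section BanachAlgebra

variable {𝔸 : Type*} [NormedRing 𝔸] [NormedAlgebra ℝ 𝔸] [CompleteSpace 𝔸]

theorem differentiableAt_exp (A : 𝔸) : DifferentiableAt ℝ (NormedSpace.exp : 𝔸 → 𝔸) A :=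
  (NormedSpace.exp_analytic A).differentiableAt

theorem continuous_exp : Continuous (NormedSpace.exp : 𝔸 → 𝔸) :=
  continuous_iff_continuousAt.2 fun A => (differentiableAt_exp A).continuousAt

/-- The mean value theorem along the curve `s ↦ exp ((1 - s) A) exp (s B)` joining `exp A` to
`exp B`. -/
theorem exists_apply_exp_sub_exp (l : 𝔸 →L[ℝ] ℝ) (A B : 𝔸) :
    ∃ s ∈ Set.Icc (0 : ℝ) 1, l (NormedSpace.exp B - NormedSpace.exp A) =
      l (NormedSpace.exp ((1 - s) • A) * (B - A) * NormedSpace.exp (s • B)) := by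
  have hd : ∀ s : ℝ, HasDerivAt
      (fun s : ℝ => l (NormedSpace.exp ((1 - s) • A) * NormedSpace.exp (s • B)))
      (l (NormedSpace.exp ((1 - s) • A) * (B - A) * NormedSpace.exp (s • B))) s := by
    intro s
    have h1 : HasDerivAt (fun s : ℝ => NormedSpace.exp ((1 - s) • A))
        (-(NormedSpace.exp ((1 - s) • A) * A)) s := by
      have := (hasDerivAt_exp_smul_const (𝕂 := ℝ) A (1 - s)).scomp s
        ((hasDerivAt_id s).const_sub 1)
      simpa [Function.comp_def] using this
    have h2 := h1.mul (hasDerivAt_exp_smul_const' (𝕂 := ℝ) B s)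
    have h3 := l.hasFDerivAt.comp_hasDerivAt s h2
    refine h3.congr_deriv (congrArg l ?_)
    simp only [mul_sub, sub_mul, neg_mul, mul_assoc]
    abel
  obtain ⟨s, hs, h⟩ := exists_hasDerivAt_eq_slope _ _ zero_lt_one
    (fun s _ => (hd s).continuousAt.continuousWithinAt) (fun s _ => hd s)
  refine ⟨s, Set.Ioo_subset_Icc_self hs, ?_⟩
  rw [h]
  simp [NormedSpace.exp_zero]

/-- A scalar form of Duhamel's formula: the average of `exp ((1 - s) A) H exp (s A)` over
`s ∈ [0, 1]`, which is the derivative of `exp`, is replaced under a functional by a single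
value of `s`. The point `s` is a cluster point of those given by the mean value theorem for the
difference quotients. -/
theorem exists_apply_fderiv_exp (l : 𝔸 →L[ℝ] ℝ) (A H : 𝔸) :
    ∃ s ∈ Set.Icc (0 : ℝ) 1, l (fderiv ℝ NormedSpace.exp A H) =
      l (NormedSpace.exp ((1 - s) • A) * H * NormedSpace.exp (s • A)) := by
  let ε : ℕ → ℝ := fun n => 1 / ((n : ℝ) + 1)
  have hε : Filter.Tendsto ε Filter.atTop (nhds 0) := tendsto_one_div_add_atTop_nhds_zero_nat
  have hε0 : ∀ n, ε n ≠ 0 := fun n => by positivity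
  choose s hs h using fun n => exists_apply_exp_sub_exp l A (A + ε n • H)
  obtain ⟨s₀, hs₀, φ, hφ, hlim⟩ := isCompact_Icc.tendsto_subseq hs
  refine ⟨s₀, hs₀, ?_⟩
  have hline : HasDerivAt (fun e : ℝ => l (NormedSpace.exp (A + e • H)))
      (l (fderiv ℝ NormedSpace.exp A H)) 0 := by
    have h1 : HasDerivAt (fun e : ℝ => A + e • H) H 0 := by
      simpa using ((hasDerivAt_id (0 : ℝ)).smul_const H).const_add A
    have h2 : HasFDerivAt (NormedSpace.exp : 𝔸 → 𝔸) (fderiv ℝ NormedSpace.exp A)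
        (A + (0 : ℝ) • H) := by
      simpa using (differentiableAt_exp A).hasFDerivAt
    exact l.hasFDerivAt.comp_hasDerivAt (0 : ℝ) (h2.comp_hasDerivAt (0 : ℝ) h1)
  have hεφ := hε.comp hφ.tendsto_atTop
  have hslope := (hasDerivAt_iff_tendsto_slope.1 hline).comp
    (tendsto_nhdsWithin_iff.2 ⟨hεφ, Filter.Eventually.of_forall fun n => hε0 (φ n)⟩)
  have hcont : Continuous fun p : ℝ × ℝ =>
      l (NormedSpace.exp ((1 - p.1) • A) * H * NormedSpace.exp (p.1 • (A + p.2 • H))) := by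
    have := continuous_exp (𝔸 := 𝔸)
    fun_prop
  have hval := (hcont.tendsto (s₀, 0)).comp (hlim.prodMk_nhds hεφ)
  simp only [zero_smul, add_zero] at hval
  refine tendsto_nhds_unique (hslope.congr fun n => ?_) hval
  have := h (φ n)
  simp only [Function.comp_apply, slope_def_field, zero_smul, add_zero, sub_zero]
  rw [← map_sub, this, add_sub_cancel_left, mul_smul_comm, smul_mul_assoc, map_smul, smul_eq_mul]
  field_simp [hε0 (φ n)]

end BanachAlgebra

/-! ### Traces and determinants of exponentials -/

attribute [local instance] Matrix.frobeniusNormedRing Matrix.frobeniusNormedAlgebra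

theorem isUnit_exp_tensor (A : Tensor) : IsUnit (NormedSpace.exp A) := Matrix.isUnit_exp A

theorem transpose_exp_of_mem (S : Sym3) :
    (NormedSpace.exp (S : Tensor))ᵀ = NormedSpace.exp (S : Tensor) := by
  rw [← Matrix.exp_transpose]
  exact congrArg _ S.2

theorem isHermitian_of_mem (S : Sym3) : (S : Tensor).IsHermitian := by
  rw [Matrix.IsHermitian, Matrix.conjTranspose_eq_transpose_of_trivial]
  exact S.2

theorem exp_eq_hermitian_cfc {A : Tensor} (hA : A.IsHermitian) :
    NormedSpace.exp A = hA.cfc Real.exp := by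
  let U : Tensorˣ := Unitary.toUnits hA.eigenvectorUnitary
  have h := hA.spectral_theorem
  rw [Unitary.conjStarAlgAut_apply] at h
  have h' := Matrix.exp_units_conj U (Matrix.diagonal hA.eigenvalues)
  rw [Matrix.exp_diagonal] at h'
  rw [Matrix.IsHermitian.cfc, Unitary.conjStarAlgAut_apply]
  conv_lhs => rw [h]
  refine h'.trans ?_
  congr 3
  ext i
  simp [Real.exp_eq_exp_ℝ, Pi.coe_exp]

/-- For symmetric `S` Jacobi's formula can be read off from the eigenvalues. -/
theorem det_exp_of_mem (S : Sym3) :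
    (NormedSpace.exp (S : Tensor)).det = Real.exp (S : Tensor).trace := by
  have hS := isHermitian_of_mem S
  rw [exp_eq_hermitian_cfc hS, hS.trace_eq_sum_eigenvalues, Matrix.IsHermitian.cfc,
    Unitary.conjStarAlgAut_apply, Matrix.det_mul, Matrix.det_mul, mul_right_comm,
    ← Matrix.det_mul]
  simp [Real.exp_sum]

theorem exp_two_smul (A : Tensor) :
    NormedSpace.exp ((2 : ℝ) • A) = NormedSpace.exp A * NormedSpace.exp A := by
  rw [two_smul, Matrix.exp_add_of_commute _ _ (Commute.refl A)]

theorem tensor_inner_def (X Y : Tensor) : inner ℝ X Y = (X * Yᵀ).trace := rfl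

theorem sym_inner_def (X Y : Sym3) : inner ℝ X Y = ((X : Tensor) * (Y : Tensor)).trace := by
  have hY : (Y : Tensor)ᵀ = Y := Y.2
  rw [Submodule.coe_inner, tensor_inner_def, hY]

theorem norm_exp_sq (S : Sym3) :
    ‖NormedSpace.exp (S : Tensor)‖ ^ 2 = (NormedSpace.exp ((2 : ℝ) • (S : Tensor))).trace := by
  rw [frobenius_sq_eq_trace, transpose_exp_of_mem, exp_two_smul]

theorem norm_exp_pos (S : Sym3) : 0 < ‖NormedSpace.exp (S : Tensor)‖ :=
  norm_pos_iff.2 (isUnit_exp_tensor _).ne_zero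

/-! ### Derivatives of the invariants of `exp S` -/

theorem trace_mul_eq_inner (X C : Tensor) : (X * C).trace = inner ℝ Cᵀ X := by
  rw [tensor_inner_def, ← Matrix.transpose_mul, Matrix.trace_transpose]

theorem exists_trace_fderiv_exp (A H C : Tensor) :
    ∃ s ∈ Set.Icc (0 : ℝ) 1, (fderiv ℝ NormedSpace.exp A H * C).trace =
      (NormedSpace.exp ((1 - s) • A) * H * NormedSpace.exp (s • A) * C).trace := by
  obtain ⟨s, hs, h⟩ := exists_apply_fderiv_exp (innerSL ℝ Cᵀ) A H
  refine ⟨s, hs, ?_⟩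
  rw [trace_mul_eq_inner, trace_mul_eq_inner]
  exact h

theorem trace_fderiv_exp (A H : Tensor) :
    (fderiv ℝ NormedSpace.exp A H).trace = (NormedSpace.exp A * H).trace := by
  obtain ⟨s, -, h⟩ := exists_trace_fderiv_exp A H 1
  rw [mul_one, mul_one, Matrix.trace_mul_comm, ← mul_assoc,
    ← Matrix.exp_add_of_commute _ _ (((Commute.refl A).smul_left s).smul_right (1 - s)),
    ← add_smul, add_sub_cancel, one_smul] at h
  exact h

/-- The second derivative of `S ↦ tr (exp (2S))` dominates the square of the first one, by the
Cauchy-Schwarz inequality for `exp ((1 - s) S) H exp (s S)` and `exp S`. This is the convexity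
of `S ↦ log (tr (exp (2S)))`. -/
theorem trace_fderiv_exp_mul (S H : Sym3) (hH : H ≠ 0) :
    0 < (fderiv ℝ NormedSpace.exp ((2 : ℝ) • (S : Tensor)) H * (H : Tensor)).trace ∧
    (NormedSpace.exp ((2 : ℝ) • (S : Tensor)) * (H : Tensor)).trace ^ 2 ≤
      ‖NormedSpace.exp (S : Tensor)‖ ^ 2 *
        (fderiv ℝ NormedSpace.exp ((2 : ℝ) • (S : Tensor)) H * (H : Tensor)).trace := by
  obtain ⟨s, -, h⟩ := exists_trace_fderiv_exp ((2 : ℝ) • (S : Tensor)) H H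
  set P : Tensor := NormedSpace.exp (((1 - s) • S : Sym3) : Tensor) with hP
  set Q : Tensor := NormedSpace.exp ((s • S : Sym3) : Tensor) with hQ
  have hPt : Pᵀ = P := transpose_exp_of_mem _
  have hQt : Qᵀ = Q := transpose_exp_of_mem _
  have hHt : (H : Tensor)ᵀ = H := H.2
  have hPP : NormedSpace.exp ((1 - s) • (2 : ℝ) • (S : Tensor)) = P * P := by
    rw [smul_comm, exp_two_smul]; rfl
  have hQQ : NormedSpace.exp (s • (2 : ℝ) • (S : Tensor)) = Q * Q := by
    rw [smul_comm, exp_two_smul]; rfl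
  have hQP : NormedSpace.exp (S : Tensor) = Q * P := by
    rw [hP, hQ, Submodule.coe_smul, Submodule.coe_smul, ← Matrix.exp_add_of_commute _ _
      (((Commute.refl (S : Tensor)).smul_left s).smul_right (1 - s)), ← add_smul,
      add_sub_cancel, one_smul]
  have hr : (fderiv ℝ NormedSpace.exp ((2 : ℝ) • (S : Tensor)) H * (H : Tensor)).trace =
      ‖P * (H : Tensor) * Q‖ ^ 2 := by
    rw [h, hPP, hQQ, frobenius_sq_eq_trace,
      Matrix.transpose_mul, Matrix.transpose_mul, hPt, hQt, hHt]
    rw [mul_assoc P P, mul_assoc P, mul_assoc P, Matrix.trace_mul_comm P]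
    simp only [mul_assoc]
  have hq : (NormedSpace.exp ((2 : ℝ) • (S : Tensor)) * (H : Tensor)).trace =
      inner ℝ (P * (H : Tensor) * Q) (NormedSpace.exp (S : Tensor)) := by
    have hPQ : NormedSpace.exp (S : Tensor) = P * Q := by
      rw [← transpose_exp_of_mem, hQP, Matrix.transpose_mul, hPt, hQt]
    have hXX : NormedSpace.exp (S : Tensor) * NormedSpace.exp (S : Tensor) =
        Q * (NormedSpace.exp (S : Tensor) * P) := by
      nth_rw 3 [hPQ]
      rw [hQP]
      simp only [mul_assoc]
    rw [exp_two_smul, tensor_inner_def, transpose_exp_of_mem, hXX, mul_assoc Q,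
      Matrix.trace_mul_comm Q, Matrix.trace_mul_comm (P * (H : Tensor) * Q)]
    simp only [mul_assoc]
  have hne : P * (H : Tensor) * Q ≠ 0 := by
    rw [Ne, (isUnit_exp_tensor _).mul_left_eq_zero, (isUnit_exp_tensor _).mul_right_eq_zero]
    simpa using hH
  refine ⟨by rw [hr]; positivity, ?_⟩
  rw [hr, hq, ← mul_pow, sq_le_sq, mul_comm, abs_of_nonneg (by positivity : 0 ≤ ‖_‖ * ‖_‖)]
  exact abs_real_inner_le_norm _ _

/-- `exp (2S)` as an element of `Sym(3)`. -/
noncomputable def expTwo (S : Sym3) : Sym3 :=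
  ⟨NormedSpace.exp ((2 : ℝ) • (S : Tensor)), transpose_exp_of_mem ((2 : ℝ) • S)⟩

/-- The identity tensor as an element of `Sym(3)`. -/
def idSym : Sym3 := ⟨1, Matrix.transpose_one⟩

theorem inner_expTwo (S H : Sym3) : inner ℝ (expTwo S) H =
    (NormedSpace.exp ((2 : ℝ) • (S : Tensor)) * (H : Tensor)).trace := sym_inner_def _ _

theorem inner_idSym (H : Sym3) : inner ℝ idSym H = (H : Tensor).trace := by
  rw [sym_inner_def, idSym, one_mul]

theorem hasFDerivAt_exp_two_smul (S : Sym3) :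
    HasFDerivAt (fun S : Sym3 => NormedSpace.exp ((2 : ℝ) • (S : Tensor)))
      ((fderiv ℝ NormedSpace.exp ((2 : ℝ) • (S : Tensor))).comp ((2 : ℝ) • Sym3.subtypeL)) S :=
  (differentiableAt_exp _).hasFDerivAt.comp S ((2 : ℝ) • Sym3.subtypeL).hasFDerivAt

/-- Projecting onto `Sym(3)` turns `exp (2S)` into a `Sym(3)`-valued function without changing it. -/
theorem differentiable_expTwo : Differentiable ℝ expTwo := by
  intro S
  have h : expTwo = fun S : Sym3 =>
      Sym3.orthogonalProjectionOnto (NormedSpace.exp ((2 : ℝ) • (S : Tensor))) :=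
    funext fun S => (Submodule.orthogonalProjectionOnto_mem_subspace_eq_self (expTwo S)).symm
  rw [h]
  exact Sym3.orthogonalProjectionOnto.differentiableAt.comp S
    (hasFDerivAt_exp_two_smul S).differentiableAt

theorem hasFDerivAt_trace (S : Sym3) :
    HasFDerivAt (fun S : Sym3 => (S : Tensor).trace) (innerSL ℝ idSym) S := by
  have h : (fun S : Sym3 => (S : Tensor).trace) = innerSL ℝ idSym :=
    funext fun S => (inner_idSym S).symm
  rw [h]
  exact (innerSL ℝ idSym).hasFDerivAt

theorem hasFDerivAt_norm_exp (S : Sym3) :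
    HasFDerivAt (fun S : Sym3 => ‖NormedSpace.exp (S : Tensor)‖)
      (‖NormedSpace.exp (S : Tensor)‖⁻¹ • innerSL ℝ (expTwo S)) S := by
  have h1 : HasFDerivAt (fun S : Sym3 => ‖NormedSpace.exp (S : Tensor)‖ ^ 2)
      ((2 : ℝ) • innerSL ℝ (expTwo S)) S := by
    simp only [norm_exp_sq]
    have htr : ∀ A : Tensor, A.trace = inner ℝ (1 : Tensor) A := fun A => by
      rw [← Matrix.transpose_one, ← trace_mul_eq_inner, mul_one]
    simp only [htr]
    refine ((innerSL ℝ (1 : Tensor)).hasFDerivAt.comp S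
      (hasFDerivAt_exp_two_smul S)).congr_fderiv ?_
    ext H
    have h := trace_fderiv_exp ((2 : ℝ) • (S : Tensor)) H
    rw [htr, ← inner_expTwo] at h
    change inner ℝ (1 : Tensor)
      (fderiv ℝ NormedSpace.exp ((2 : ℝ) • (S : Tensor)) ((2 : ℝ) • (H : Tensor))) =
        2 * inner ℝ (expTwo S) H
    rw [map_smul, inner_smul_right, h]
  have h2 := h1.sqrt (pow_pos (norm_exp_pos S) 2).ne'
  simp only [Real.sqrt_sq (norm_nonneg _)] at h2
  refine h2.congr_fderiv ?_
  rw [smul_smul]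
  congr 1
  field_simp

/-! ### The Cauchy stress -/

theorem henckyEnergy_of_lt {β c : ℝ} {S : Sym3} (h : (S : Tensor).trace ^ 2 < β) :
    henckyEnergy (volumeLimitedEnergy β c) S =
      ((‖NormedSpace.exp (S : Tensor)‖ ^ 3 / (β - (S : Tensor).trace ^ 2) -
        3 * Real.sqrt 3 / β * Real.exp (S : Tensor).trace + c : ℝ) : EReal) := by
  rw [henckyEnergy, volumeLimitedEnergy, det_exp_of_mem, Real.log_exp,
    if_pos ⟨Real.exp_pos _, h⟩]

theorem mem_admissible_iff {β c : ℝ} {S : Sym3} :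
    S ∈ admissible (volumeLimitedEnergy β c) ↔ (S : Tensor).trace ^ 2 < β := by
  refine ⟨fun h => ?_, fun h => ?_⟩
  · by_contra hn
    refine (show henckyEnergy _ S < ⊤ from h).ne ?_
    rw [henckyEnergy, volumeLimitedEnergy, det_exp_of_mem, Real.log_exp,
      if_neg fun h' => hn h'.2]
  · change henckyEnergy _ S < ⊤
    rw [henckyEnergy_of_lt h]
    exact EReal.coe_lt_top _

theorem continuous_trace_sym : Continuous fun S : Sym3 => (S : Tensor).trace :=
  continuous_iff_continuousAt.2 fun S => (hasFDerivAt_trace S).continuousAt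

theorem isOpen_admissible (β c : ℝ) : IsOpen (admissible (volumeLimitedEnergy β c)) := by
  have h : admissible (volumeLimitedEnergy β c) = {S : Sym3 | (S : Tensor).trace ^ 2 < β} :=
    Set.ext fun S => mem_admissible_iff
  rw [h]
  exact isOpen_lt (continuous_trace_sym.pow 2) continuous_const

theorem convex_admissible (β c : ℝ) : Convex ℝ (admissible (volumeLimitedEnergy β c)) := by
  intro S hS S' hS' a b ha hb hab
  rw [mem_admissible_iff] at *
  have h := (even_two.convexOn_pow (𝕜 := ℝ)).2 (Set.mem_univ (S : Tensor).trace)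
    (Set.mem_univ (S' : Tensor).trace) ha hb hab
  simp only [Submodule.coe_add, Submodule.coe_smul, Matrix.trace_add, Matrix.trace_smul]
  refine h.trans_lt ?_
  simp only [smul_eq_mul]
  rcases ha.eq_or_lt with rfl | ha'
  · obtain rfl : b = 1 := by linarith
    linarith
  · nlinarith [mul_lt_mul_of_pos_left hS ha', mul_le_mul_of_nonneg_left hS'.le hb]

theorem sym_inner_smul_left (a : ℝ) (X Y : Sym3) : inner ℝ (a • X) Y = a * inner ℝ X Y := by
  rw [sym_inner_def, sym_inner_def, Submodule.coe_smul, Matrix.smul_mul, Matrix.trace_smul,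
    smul_eq_mul]

/-- The gradient of `S ↦ ‖exp S‖³ / (β - (tr S)²) - k exp (tr S) + c`. -/
noncomputable def energyGradient (β k : ℝ) (S : Sym3) : Sym3 :=
  (3 * ‖NormedSpace.exp (S : Tensor)‖ / (β - (S : Tensor).trace ^ 2)) • expTwo S +
    (2 * (S : Tensor).trace * ‖NormedSpace.exp (S : Tensor)‖ ^ 3 /
      (β - (S : Tensor).trace ^ 2) ^ 2 - k * Real.exp (S : Tensor).trace) • idSym

theorem hasGradientAt_realEnergy {β c : ℝ} {S : Sym3} (h : (S : Tensor).trace ^ 2 < β) :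
    HasGradientAt (realEnergy (volumeLimitedEnergy β c))
      (energyGradient β (3 * Real.sqrt 3 / β) S) S := by
  set k := 3 * Real.sqrt 3 / β with hk
  have hev : (fun S : Sym3 => ‖NormedSpace.exp (S : Tensor)‖ ^ 3 / (β - (S : Tensor).trace ^ 2) -
      k * Real.exp (S : Tensor).trace + c) =ᶠ[nhds S]
      realEnergy (volumeLimitedEnergy β c) := by
    filter_upwards [(isOpen_admissible β c).mem_nhds (mem_admissible_iff.2 h)] with S' hS'
    rw [realEnergy, henckyEnergy_of_lt (mem_admissible_iff.1 hS'), EReal.toReal_coe]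
  rw [hasGradientAt_iff_hasFDerivAt]
  refine HasFDerivAt.congr_of_eventuallyEq ?_ hev.symm
  have hg : β - (S : Tensor).trace ^ 2 ≠ 0 := (sub_pos.2 h).ne'
  have hn := (norm_exp_pos S).ne'
  have ht := hasFDerivAt_trace S
  have hinv : HasFDerivAt (fun S : Sym3 => (β - (S : Tensor).trace ^ 2)⁻¹) _ S :=
    (hasDerivAt_inv hg).comp_hasFDerivAt S ((ht.pow 2).const_sub β)
  simp only [div_eq_mul_inv _ (β - _)]
  refine (((((hasFDerivAt_norm_exp S).pow 3).mul hinv).sub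
    (ht.exp.const_mul k)).add_const c).congr_fderiv ?_
  ext H
  change _ = inner ℝ (energyGradient β k S) H
  simp only [energyGradient, inner_add_left, sym_inner_smul_left]
  simp
  field_simp
  ring

theorem hasCauchyStress_volumeLimitedEnergy (β c : ℝ) :
    HasCauchyStress (volumeLimitedEnergy β c) :=
  ⟨isOpen_admissible β c, fun _ hS => (hasGradientAt_iff_hasFDerivAt.1
    (hasGradientAt_realEnergy (mem_admissible_iff.1 hS))).differentiableAt.differentiableWithinAt⟩

theorem cauchyStress_eq {β c : ℝ} {S : Sym3} (h : (S : Tensor).trace ^ 2 < β) :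
    cauchyStress (volumeLimitedEnergy β c) S =
      Real.exp (-(S : Tensor).trace) • energyGradient β (3 * Real.sqrt 3 / β) S := by
  rw [cauchyStress, (hasGradientAt_realEnergy h).gradient, det_exp_of_mem, Real.exp_neg]

theorem differentiableAt_energyGradient {β k : ℝ} {S : Sym3} (h : (S : Tensor).trace ^ 2 < β) :
    DifferentiableAt ℝ (energyGradient β k) S := by
  have hg : β - (S : Tensor).trace ^ 2 ≠ 0 := (sub_pos.2 h).ne'
  have ht := (hasFDerivAt_trace S).differentiableAt
  have hn := (hasFDerivAt_norm_exp S).differentiableAt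
  have he := differentiable_expTwo S
  have hg2 : (β - (S : Tensor).trace ^ 2) ^ 2 ≠ 0 := pow_ne_zero 2 hg
  have h1 : DifferentiableAt ℝ (fun S : Sym3 => 3 * ‖NormedSpace.exp (S : Tensor)‖ /
      (β - (S : Tensor).trace ^ 2)) S := by
    simp only [div_eq_mul_inv]
    exact (hn.const_mul 3).mul (((ht.pow 2).const_sub β).inv hg)
  have h2 : DifferentiableAt ℝ (fun S : Sym3 => 2 * (S : Tensor).trace *
      ‖NormedSpace.exp (S : Tensor)‖ ^ 3 / (β - (S : Tensor).trace ^ 2) ^ 2) S := by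
    simp only [div_eq_mul_inv]
    exact ((ht.const_mul 2).mul (hn.pow 3)).mul ((((ht.pow 2).const_sub β).pow 2).inv hg2)
  exact (h1.smul he).add ((h2.sub (ht.exp.const_mul k)).smul_const idSym)

theorem differentiableAt_cauchyStress {β c : ℝ} {S : Sym3} (h : (S : Tensor).trace ^ 2 < β) :
    DifferentiableAt ℝ (cauchyStress (volumeLimitedEnergy β c)) S := by
  have hev : cauchyStress (volumeLimitedEnergy β c) =ᶠ[nhds S] fun S : Sym3 =>
      Real.exp (-(S : Tensor).trace) • energyGradient β (3 * Real.sqrt 3 / β) S := by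
    filter_upwards [(isOpen_admissible β c).mem_nhds (mem_admissible_iff.2 h)] with S' hS'
    exact cauchyStress_eq (mem_admissible_iff.1 hS')
  refine DifferentiableAt.congr_of_eventuallyEq ?_ hev
  exact (hasFDerivAt_trace S).differentiableAt.neg.exp.smul (differentiableAt_energyGradient h)

/-! ### Strict monotonicity of the Cauchy stress -/

/-- With `N = ‖exp S‖²`, `t = tr S`, `g = β - t²`, this is the derivative of the Cauchy stress in
the direction `H` paired with `H`, up to the factor `e⁻ᵗ N^(3/2) / g`. Here `a = 2 t / g`,
`h = tr H`, `m = tr (exp (2S) H) / N`, and `2 V` is the derivative of `tr (exp (2S) H) / N` with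
`N` frozen. -/
theorem stress_form_pos {β g a h m V : ℝ} (hg : 0 < g) (hgβ : g ≤ β) (hβ : β ≤ 27 / 4)
    (hV : 0 < V) (hmV : m ^ 2 ≤ V) :
    0 < 6 * V + 3 * m ^ 2 + (6 * a - 3) * m * h + (2 * a ^ 2 - a + 2 / g) * h ^ 2 := by
  -- The sharp condition for the quadratic form in `(m, h)` is `8 / g + 4 a² > 1`.
  have h2g : 1 / 4 < 2 / g := by
    rw [lt_div_iff₀ hg]; linarith
  have hid : 6 * V + 3 * m ^ 2 + (6 * a - 3) * m * h + (2 * a ^ 2 - a + 2 / g) * h ^ 2 =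
      6 * (V - m ^ 2) + (3 * m + (a - 1 / 2) * h) ^ 2 + (a ^ 2 + (2 / g - 1 / 4)) * h ^ 2 := by
    ring
  by_cases hh : h = 0
  · subst hh
    nlinarith [sq_nonneg m]
  · rw [hid]
    have := mul_pos (add_pos_of_nonneg_of_pos (sq_nonneg a) (sub_pos.2 h2g))
      (by positivity : 0 < h ^ 2)
    nlinarith [sq_nonneg (3 * m + (a - 1 / 2) * h)]

theorem inner_fderiv_cauchyStress_pos {β c : ℝ} (hβ : β ≤ 27 / 4) {S : Sym3}
    (hS : (S : Tensor).trace ^ 2 < β) {H : Sym3} (hH : H ≠ 0) :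
    0 < inner ℝ (fderiv ℝ (cauchyStress (volumeLimitedEnergy β c)) S H) H := by
  set k := 3 * Real.sqrt 3 / β with hk
  set n := ‖NormedSpace.exp (S : Tensor)‖ with hn
  set t := (S : Tensor).trace with ht
  set q := inner ℝ (expTwo S) H with hq
  set r := (fderiv ℝ NormedSpace.exp ((2 : ℝ) • (S : Tensor)) H * (H : Tensor)).trace with hr
  set h := (H : Tensor).trace with hh
  obtain ⟨hr0, hqr⟩ := trace_fderiv_exp_mul S H hH
  rw [← inner_expTwo, ← hq, ← hr, ← hn] at hqr
  have hn0 : 0 < n := norm_exp_pos S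
  have hg0 : 0 < β - t ^ 2 := sub_pos.2 hS
  have hnl : HasLineDerivAt ℝ (fun S : Sym3 => ‖NormedSpace.exp (S : Tensor)‖) (q / n) S H := by
    have := (hasFDerivAt_norm_exp S).hasLineDerivAt H
    rwa [smul_apply, innerSL_apply_apply, smul_eq_mul, inv_mul_eq_div] at this
  have htl : HasLineDerivAt ℝ (fun S : Sym3 => (S : Tensor).trace) h S H := by
    have := (hasFDerivAt_trace S).hasLineDerivAt H
    rwa [innerSL_apply_apply, inner_idSym] at this
  have hql : HasLineDerivAt ℝ (fun S : Sym3 => inner ℝ (expTwo S) H) (2 * r) S H := by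
    have hin : ∀ X : Sym3, inner ℝ X H = inner ℝ (H : Tensor) (X : Tensor) := fun X => by
      rw [real_inner_comm, Submodule.coe_inner]
    simp only [hin]
    have h1 := (((innerSL ℝ (H : Tensor)).hasFDerivAt.comp S
      (hasFDerivAt_exp_two_smul S))).hasLineDerivAt H
    have h2 : (2 * r) = inner ℝ (H : Tensor)
        (fderiv ℝ NormedSpace.exp ((2 : ℝ) • (S : Tensor)) ((2 : ℝ) • (H : Tensor))) := by
      have hHt : (H : Tensor)ᵀ = H := H.2
      rw [map_smul, inner_smul_right, hr, trace_mul_eq_inner, hHt]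
    rw [h2]
    exact h1
  have hσl : HasLineDerivAt ℝ
      (fun S => inner ℝ (cauchyStress (volumeLimitedEnergy β c) S) H)
      (inner ℝ (fderiv ℝ (cauchyStress (volumeLimitedEnergy β c)) S H) H) S H := by
    have h1 := ((differentiableAt_cauchyStress (c := c) hS).hasFDerivAt.inner ℝ
      (hasFDerivAt_const H S)).hasLineDerivAt H
    rw [HasLineDerivAt]
    refine HasDerivAt.congr_deriv h1 ?_
    change inner ℝ _ (0 : Sym3) + inner ℝ _ H = _
    rw [inner_zero_right, zero_add]
    rfl
  have hev : (fun S => inner ℝ (cauchyStress (volumeLimitedEnergy β c) S) H) =ᶠ[nhds S]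
      fun S : Sym3 => Real.exp (-(S : Tensor).trace) *
        (3 * ‖NormedSpace.exp (S : Tensor)‖ / (β - (S : Tensor).trace ^ 2) *
          inner ℝ (expTwo S) H + 2 * (S : Tensor).trace * ‖NormedSpace.exp (S : Tensor)‖ ^ 3 /
            (β - (S : Tensor).trace ^ 2) ^ 2 * h) - k * h := by
    filter_upwards [(isOpen_admissible β c).mem_nhds (mem_admissible_iff.2 hS)] with S' hS'
    rw [cauchyStress_eq (mem_admissible_iff.1 hS'), energyGradient, sym_inner_smul_left,
      inner_add_left, sym_inner_smul_left, sym_inner_smul_left, inner_idSym, Real.exp_neg, ← hh,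
      ← hk]
    have hg' : β - (S' : Tensor).trace ^ 2 ≠ 0 := (sub_pos.2 (mem_admissible_iff.1 hS')).ne'
    have := (Real.exp_pos (S' : Tensor).trace).ne'
    field_simp
    ring
  have hexp : HasLineDerivAt ℝ
      (fun S => inner ℝ (cauchyStress (volumeLimitedEnergy β c) S) H)
      (Real.exp (-t) * (n ^ 3 / (β - t ^ 2)) * (6 * (r / n ^ 2) + 3 * (q / n ^ 2) ^ 2 +
        (6 * (2 * t / (β - t ^ 2)) - 3) * (q / n ^ 2) * h +
        (2 * (2 * t / (β - t ^ 2)) ^ 2 - 2 * t / (β - t ^ 2) + 2 / (β - t ^ 2)) * h ^ 2)) S H := by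
    refine HasLineDerivAt.congr_of_eventuallyEq ?_ hev
    have hzero : S + (0 : ℝ) • H = S := by simp
    have hg : β - ((S + (0 : ℝ) • H : Sym3) : Tensor).trace ^ 2 ≠ 0 := by rw [hzero]; exact hg0.ne'
    have hgd := (HasDerivAt.pow htl 2).const_sub β
    have hd := ((HasDerivAt.exp (HasDerivAt.neg htl)).mul
      ((((HasDerivAt.const_mul 3 hnl).div hgd hg).mul hql).add
        ((((HasDerivAt.const_mul 2 htl).mul (HasDerivAt.pow hnl 3)).div (hgd.pow 2)
          (pow_ne_zero 2 hg)).mul_const h))).sub_const (k * h)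
    refine HasDerivAt.congr_deriv hd ?_
    simp only [Pi.pow_apply, Pi.mul_apply, Pi.neg_apply, Pi.add_apply, Pi.div_apply, hzero]
    simp only [← ht, ← hn, ← hq]
    have := hn0.ne'
    have := hg0.ne'
    field_simp
    ring
  rw [hσl.unique hexp]
  refine mul_pos (by positivity) (stress_form_pos hg0 (by nlinarith [sq_nonneg t]) hβ
    (by positivity) ?_)
  rw [div_pow, div_le_div_iff₀ (by positivity) (by positivity)]
  nlinarith [mul_le_mul_of_nonneg_right hqr (by positivity : 0 ≤ n ^ 2)]

theorem isTSTSMpp_volumeLimitedEnergy {β : ℝ} (hβ : β ≤ 27 / 4) (c : ℝ) :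
    IsTSTSMpp (volumeLimitedEnergy β c) :=
  ⟨hasCauchyStress_volumeLimitedEnergy β c, fun _ hS =>
    ⟨differentiableAt_cauchyStress (mem_admissible_iff.1 hS), fun _ hH =>
      inner_fderiv_cauchyStress_pos hβ (mem_admissible_iff.1 hS) hH⟩⟩

/-- On a convex set of admissible strains a positive definite derivative gives strict
monotonicity, by the mean value theorem along the segment. -/
theorem IsTSTSMpp.isTSTSMp {W : Tensor → EReal} (hW : IsTSTSMpp W)
    (hc : Convex ℝ (admissible W)) : IsTSTSMp W := by
  refine ⟨hW.1, fun S hS S' hS' hne => ?_⟩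
  have hmem : ∀ s ∈ Set.Icc (0 : ℝ) 1, S + s • (S' - S) ∈ admissible W := fun s hs =>
    hc.add_smul_sub_mem hS hS' hs
  have hd : ∀ s ∈ Set.Icc (0 : ℝ) 1, HasDerivAt
      (fun s : ℝ => inner ℝ (cauchyStress W (S + s • (S' - S))) (S' - S))
      (inner ℝ (fderiv ℝ (cauchyStress W) (S + s • (S' - S)) (S' - S)) (S' - S)) s := by
    intro s hs
    have h1 : HasDerivAt (fun s : ℝ => S + s • (S' - S)) (S' - S) s := by
      exact (((hasDerivAt_id s).smul_const (S' - S)).const_add S).congr_deriv (one_smul _ _)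
    have h2 := ((hW.2 _ (hmem s hs)).1.hasFDerivAt.comp_hasDerivAt s h1).inner ℝ
      (hasDerivAt_const s (S' - S))
    exact h2.congr_deriv (by rw [inner_zero_right, zero_add]; rfl)
  obtain ⟨s, hs, h⟩ := exists_hasDerivAt_eq_slope _ _ zero_lt_one
    (fun s hs => (hd s hs).continuousAt.continuousWithinAt)
    (fun s hs => hd s (Set.Ioo_subset_Icc_self hs))
  have hpos := (hW.2 _ (hmem s (Set.Ioo_subset_Icc_self hs))).2 _ (sub_ne_zero.2 hne.symm)
  rw [h] at hpos
  simpa [inner_sub_left] using hpos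

/-! ### Polyconvexity of the energy -/

/-- The cubic controlling the concavity of `√(β - log²)`, at `t = log d`. The bound
`β ≤ 27 / 4` is the minimum of `t³ / (t - 1)` over `t > 1`. -/
theorem concavity_cubic_nonneg {β t : ℝ} (hβ : β ≤ 27 / 4) (ht : t ^ 2 < β) :
    0 ≤ t ^ 2 + (1 - t) * (β - t ^ 2) := by
  have hβ0 : 0 ≤ β := (sq_nonneg t).trans ht.le
  rcases le_or_gt t 1 with h | h
  · have := mul_nonneg (sub_nonneg.2 h) (sub_pos.2 ht).le
    positivity
  · -- `4 t³ - 27 (t - 1) = (2 t - 3)² (t + 3)`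
    have h1 := mul_nonneg (sq_nonneg (2 * t - 3)) (by linarith : 0 ≤ t + 3)
    nlinarith [mul_le_mul_of_nonneg_right hβ (sub_pos.2 h).le]

theorem log_sq_lt_iff {β d : ℝ} (hd : 0 < d) :
    Real.log d ^ 2 < β ↔ d ∈ Set.Ioo (Real.exp (-√β)) (Real.exp √β) := by
  rw [Real.sq_lt, Set.mem_Ioo, Real.lt_log_iff_exp_lt hd, Real.log_lt_iff_lt_exp hd]

theorem concaveOn_sqrt_sub_log_sq {β : ℝ} (hβ : β ≤ 27 / 4) :
    ConcaveOn ℝ (Set.Ioo (Real.exp (-√β)) (Real.exp √β))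
      fun d => √(β - Real.log d ^ 2) := by
  have hpos : ∀ d ∈ Set.Ioo (Real.exp (-√β)) (Real.exp √β), 0 < d := fun d hd =>
    (Real.exp_pos _).trans hd.1
  have hg : ∀ d ∈ Set.Ioo (Real.exp (-√β)) (Real.exp √β), 0 < β - Real.log d ^ 2 :=
    fun d hd => sub_pos.2 ((log_sq_lt_iff (hpos d hd)).2 hd)
  have hd1 : ∀ d ∈ Set.Ioo (Real.exp (-√β)) (Real.exp √β),
      HasDerivAt (fun d => √(β - Real.log d ^ 2))
        (-(Real.log d / (d * √(β - Real.log d ^ 2)))) d := by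
    intro d hd
    have h := ((((Real.hasDerivAt_log (hpos d hd).ne').pow 2).const_sub β).sqrt (hg d hd).ne')
    refine h.congr_deriv ?_
    have := (hpos d hd).ne'
    have := (Real.sqrt_pos.2 (hg d hd)).ne'
    simp only [Pi.pow_apply]
    field_simp
    ring
  refine concaveOn_of_hasDerivWithinAt2_nonpos (convex_Ioo _ _)
    (f' := fun d => -(Real.log d / (d * √(β - Real.log d ^ 2))))
    (f'' := fun d => -((Real.log d ^ 2 + (1 - Real.log d) * (β - Real.log d ^ 2)) /
      (d ^ 2 * √(β - Real.log d ^ 2) ^ 3)))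
    (fun d hd => (hd1 d hd).continuousAt.continuousWithinAt) ?_ ?_ ?_
  all_goals
    rw [interior_Ioo]
    intro d hd
  · exact (hd1 d hd).hasDerivWithinAt
  · refine HasDerivAt.hasDerivWithinAt ?_
    have hd0 := (hpos d hd).ne'
    have hs0 := (Real.sqrt_pos.2 (hg d hd)).ne'
    have h := ((Real.hasDerivAt_log hd0).div ((hasDerivAt_id d).mul (hd1 d hd))
      (mul_ne_zero hd0 hs0)).neg
    refine h.congr_deriv ?_
    simp only [Pi.mul_apply, id]
    have hsq := Real.sq_sqrt (hg d hd).le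
    have hnum : Real.log d ^ 2 + (1 - Real.log d) * (β - Real.log d ^ 2) =
        Real.log d ^ 2 + (1 - Real.log d) * √(β - Real.log d ^ 2) ^ 2 := by rw [hsq]
    rw [hnum]
    field_simp
    ring
  · have := hpos d hd
    have := Real.sqrt_pos.2 (hg d hd)
    have := concavity_cubic_nonneg hβ ((log_sq_lt_iff (hpos d hd)).2 hd)
    rw [neg_nonpos]
    positivity

/-- The tangent plane of `x³ / s²` at a point with `x / s = ρ` lies below its graph. -/
theorem tangent_le_cube_div_sq {x s ρ : ℝ} (hx : 0 ≤ x) (hs : 0 < s) (hρ : 0 ≤ ρ) :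
    3 * ρ ^ 2 * x - 2 * ρ ^ 3 * s ≤ x ^ 3 / s ^ 2 := by
  rw [le_div_iff₀ (by positivity)]
  have := mul_nonneg (sq_nonneg (x - ρ * s)) (by positivity : 0 ≤ x + 2 * (ρ * s))
  nlinarith

/-- Joint convexity of `x³ / s²`, together with its monotonicity in each variable. -/
theorem cube_div_sq_le {x s x₁ s₁ x₂ s₂ a b : ℝ} (hx : 0 ≤ x) (hx₁ : 0 ≤ x₁) (hx₂ : 0 ≤ x₂)
    (hs₁ : 0 < s₁) (hs₂ : 0 < s₂) (ha : 0 < a) (hb : 0 < b)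
    (hxle : x ≤ a * x₁ + b * x₂) (hsle : a * s₁ + b * s₂ ≤ s) :
    x ^ 3 / s ^ 2 ≤ a * (x₁ ^ 3 / s₁ ^ 2) + b * (x₂ ^ 3 / s₂ ^ 2) := by
  have hu : 0 ≤ a * x₁ + b * x₂ := by positivity
  have hv : 0 < a * s₁ + b * s₂ := by positivity
  have hρ := div_nonneg hu hv.le
  calc x ^ 3 / s ^ 2 ≤ (a * x₁ + b * x₂) ^ 3 / (a * s₁ + b * s₂) ^ 2 := by gcongr
    _ = a * (3 * ((a * x₁ + b * x₂) / (a * s₁ + b * s₂)) ^ 2 * x₁ -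
          2 * ((a * x₁ + b * x₂) / (a * s₁ + b * s₂)) ^ 3 * s₁) +
        b * (3 * ((a * x₁ + b * x₂) / (a * s₁ + b * s₂)) ^ 2 * x₂ -
          2 * ((a * x₁ + b * x₂) / (a * s₁ + b * s₂)) ^ 3 * s₂) := by
      field_simp
      ring
    _ ≤ _ := add_le_add (mul_le_mul_of_nonneg_left (tangent_le_cube_div_sq hx₁ hs₁ hρ) ha.le)
        (mul_le_mul_of_nonneg_left (tangent_le_cube_div_sq hx₂ hs₂ hρ) hb.le)

/-- To prove convexity of an `EReal`-valued function it suffices to compare values at two points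
of finite value with positive weights. -/
theorem ExtConvexOn.of_ne_top {E : Type*} [AddCommGroup E] [Module ℝ E] {s : Set E}
    {f : E → EReal} (hs : Convex ℝ s) (hbot : ∀ x ∈ s, f x ≠ ⊥)
    (h : ∀ x ∈ s, ∀ y ∈ s, ∀ a b : ℝ, 0 < a → 0 < b → a + b = 1 → f x ≠ ⊤ → f y ≠ ⊤ →
      f (a • x + b • y) ≤ (a : EReal) * f x + (b : EReal) * f y) : ExtConvexOn s f := by
  have hmul : ∀ {a : ℝ} {x : E}, 0 < a → x ∈ s → (a : EReal) * f x ≠ ⊥ := by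
    intro a x ha hx hab
    rcases (EReal.mul_eq_bot _ _).1 hab with h' | h' | h' | h'
    · exact EReal.coe_ne_bot _ h'.1
    · exact hbot x hx h'.2
    · exact EReal.coe_ne_top _ h'.1
    · exact absurd h'.1 (not_lt.2 (EReal.coe_nonneg.2 ha.le))
  refine ⟨hs, hbot, fun x hx y hy a b ha hb hab => ?_⟩
  rcases ha.eq_or_lt with rfl | ha
  · obtain rfl : b = 1 := by linarith
    simp
  rcases hb.eq_or_lt with rfl | hb
  · obtain rfl : a = 1 := by linarith
    simp
  by_cases hfx : f x = ⊤
  · rw [hfx, EReal.coe_mul_top_of_pos ha, EReal.top_add_of_ne_bot (hmul hb hy)]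
    exact le_top
  by_cases hfy : f y = ⊤
  · rw [hfy, EReal.coe_mul_top_of_pos hb, EReal.add_top_of_ne_bot (hmul ha hx)]
    exact le_top
  exact h x hx y hy a b ha hb hab hfx hfy

open Classical in
/-- The energy as a function of `(F, cof F, det F)`; it does not depend on the cofactor. -/
noncomputable def polyconvexDensity (β c : ℝ) (X : Tensor × Tensor × ℝ) : EReal :=
  if Real.log X.2.2 ^ 2 < β then
    ((‖X.1‖ ^ 3 / (β - Real.log X.2.2 ^ 2) - 3 * Real.sqrt 3 / β * X.2.2 + c : ℝ) : EReal)
  else ⊤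

theorem extConvexOn_polyconvexDensity {β : ℝ} (hβ : β ≤ 27 / 4) (c : ℝ) :
    ExtConvexOn {X : Tensor × Tensor × ℝ | 0 < X.2.2} (polyconvexDensity β c) := by
  refine ExtConvexOn.of_ne_top ?_ ?_ ?_
  · intro X hX Y hY a b ha hb hab
    exact convex_Ioi (0 : ℝ) hX hY ha hb hab
  · intro X _
    rw [polyconvexDensity]
    split_ifs
    · exact EReal.coe_ne_bot _
    · exact top_ne_bot
  · rintro ⟨F, C, d⟩ hd ⟨F', C', d'⟩ hd' a b ha hb hab hX hY
    have hlog : Real.log d ^ 2 < β := by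
      by_contra h
      exact hX (if_neg h)
    have hlog' : Real.log d' ^ 2 < β := by
      by_contra h
      exact hY (if_neg h)
    have hm := (log_sq_lt_iff hd).1 hlog
    have hm' := (log_sq_lt_iff hd').1 hlog'
    have hd'' : 0 < a * d + b * d' := convex_Ioi (0 : ℝ) hd hd' ha.le hb.le hab
    have hlog'' : Real.log (a * d + b * d') ^ 2 < β :=
      (log_sq_lt_iff hd'').2 (convex_Ioo _ _ hm hm' ha.le hb.le hab)
    have hs := (concaveOn_sqrt_sub_log_sq hβ).2 hm hm' ha.le hb.le hab
    have hF : ‖a • F + b • F'‖ ≤ a * ‖F‖ + b * ‖F'‖ := by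
      refine (norm_add_le _ _).trans_eq ?_
      rw [norm_smul, norm_smul, Real.norm_of_nonneg ha.le, Real.norm_of_nonneg hb.le]
    have hkey := cube_div_sq_le (norm_nonneg (a • F + b • F')) (norm_nonneg F) (norm_nonneg F')
      (Real.sqrt_pos.2 (sub_pos.2 hlog)) (Real.sqrt_pos.2 (sub_pos.2 hlog')) ha hb hF hs
    simp only [smul_eq_mul] at hkey
    rw [Real.sq_sqrt (sub_pos.2 hlog).le, Real.sq_sqrt (sub_pos.2 hlog').le,
      Real.sq_sqrt (sub_pos.2 hlog'').le] at hkey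
    simp only [polyconvexDensity, Prod.smul_mk, Prod.mk_add_mk, smul_eq_mul]
    rw [if_pos hlog, if_pos hlog', if_pos hlog'']
    norm_cast
    have hc : c = a * c + b * c := by rw [← add_mul, hab, one_mul]
    linarith

theorem isPolyconvex_volumeLimitedEnergy {β : ℝ} (hβ : β ≤ 27 / 4) (c : ℝ) :
    IsPolyconvex (volumeLimitedEnergy β c) := by
  refine ⟨polyconvexDensity β c, extConvexOn_polyconvexDensity hβ c, fun F hF => ?_⟩
  rw [volumeLimitedEnergy, polyconvexDensity]
  exact if_congr (and_iff_right hF) rfl rfl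

/-! ### Dependence on the Hencky strain alone -/

theorem volumeLimitedEnergy_congr {β c : ℝ} {F G : Tensor} (hdet : F.det = G.det)
    (hnorm : ‖F‖ = ‖G‖) : volumeLimitedEnergy β c F = volumeLimitedEnergy β c G := by
  rw [volumeLimitedEnergy, volumeLimitedEnergy, hdet, hnorm]

theorem exp_henckyStrain_sq {F : Tensor} (hF : 0 < F.det) :
    NormedSpace.exp (henckyStrain F : Tensor) * NormedSpace.exp (henckyStrain F : Tensor) =
      F * Fᵀ := by
  have hFu : IsUnit F := (Matrix.isUnit_iff_isUnit_det F).2 hF.ne'.isUnit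
  have hpd : (F * Fᵀ).PosDef := by
    rw [← Matrix.conjTranspose_eq_transpose_of_trivial]
    exact Matrix.PosDef.mul_conjTranspose_self F (Matrix.vecMul_injective_of_isUnit hFu)
  have hsa : IsSelfAdjoint (F * Fᵀ) := hpd.isHermitian
  have hfin : (spectrum ℝ (F * Fᵀ)).Finite := Matrix.finite_real_spectrum
  have hpos : ∀ x ∈ spectrum ℝ (F * Fᵀ), 0 < x := by
    intro x hx
    rw [hpd.isHermitian.spectrum_real_eq_range_eigenvalues] at hx
    obtain ⟨i, rfl⟩ := hx
    exact hpd.eigenvalues_pos i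
  have hlog : cfc Real.log (leftStretch F) = cfc (Real.log ∘ Real.sqrt) (F * Fᵀ) :=
    (cfc_comp _ _ _ hsa ((hfin.image _).continuousOn _) (hfin.continuousOn _)).symm
  have hexp : NormedSpace.exp (henckyStrain F : Tensor) =
      cfc (Real.exp ∘ Real.log ∘ Real.sqrt) (F * Fᵀ) := by
    rw [exp_eq_hermitian_cfc (isHermitian_of_mem _), ← Matrix.IsHermitian.cfc_eq]
    change cfc Real.exp (cfc Real.log (leftStretch F)) = _
    rw [hlog]
    exact (cfc_comp _ _ _ hsa ((hfin.image _).continuousOn _) (hfin.continuousOn _)).symm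
  rw [hexp, ← cfc_mul _ _ _ (hfin.continuousOn _) (hfin.continuousOn _)]
  conv_rhs => rw [← cfc_id' ℝ (F * Fᵀ) hsa]
  refine cfc_congr fun x hx => ?_
  have hx0 := hpos x hx
  simp only [Function.comp_apply]
  rw [Real.exp_log (Real.sqrt_pos.2 hx0), Real.mul_self_sqrt hx0.le]

theorem factorsThroughHencky_volumeLimitedEnergy (β c : ℝ) :
    FactorsThroughHencky (volumeLimitedEnergy β c) := by
  intro F hF
  have h := exp_henckyStrain_sq hF
  refine volumeLimitedEnergy_congr ?_ ?_
  · have hdet := congrArg Matrix.det h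
    rw [Matrix.det_mul, Matrix.det_mul, Matrix.det_transpose] at hdet
    have hpos : 0 < (NormedSpace.exp (henckyStrain F : Tensor)).det := by
      rw [det_exp_of_mem]
      exact Real.exp_pos _
    exact ((mul_self_inj hpos.le hF.le).1 hdet).symm
  · refine (pow_left_inj₀ (norm_nonneg _) (norm_nonneg _) two_ne_zero).1 ?_
    rw [frobenius_sq_eq_trace, frobenius_sq_eq_trace, transpose_exp_of_mem, h]

end Hyperelasticity

theorem mainTheorem7 (β c : ℝ) (hβ_pos : 0 < β) (hβ_le : β ≤ 27 / 4) :
    Hyperelasticity.IsPolyconvex (Hyperelasticity.volumeLimitedEnergy β c) ∧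
    Hyperelasticity.FactorsThroughHencky (Hyperelasticity.volumeLimitedEnergy β c) ∧
    Hyperelasticity.IsTSTSMpp (Hyperelasticity.volumeLimitedEnergy β c) ∧
    Hyperelasticity.IsTSTSMp (Hyperelasticity.volumeLimitedEnergy β c) :=
  have h := Hyperelasticity.isTSTSMpp_volumeLimitedEnergy hβ_le c
  ⟨Hyperelasticity.isPolyconvex_volumeLimitedEnergy hβ_le c,
    Hyperelasticity.factorsThroughHencky_volumeLimitedEnergy β c, h,
    h.isTSTSMp (Hyperelasticity.convex_admissible β c)⟩
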